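/- **Definitions.** Let $C$ be a unital $C^*$-algebra. For hermitian $a,b\in C$ put $a\wedge b=\frac{a+b}{2}-\frac{|a-b|}{2}$ and $a\vee b=\frac{a+b}{2}+\frac{|a-b|}{2}$, where $|c|=\sqrt{c^*c}$. A *pre-isocone* of $C$ is a closed set $I$ of hermitian elements of $C$ which is stable under sums, under multiplication by non-negative reals, under $\wedge$ and $\vee$, and contains $x1$ for every $x\in\mathbb R$. It is an *isocone* if moreover its linear span is dense in $C$; then $(I,C)$ is called an *$I^*$-algebra*. An *$I^*$-morphism* $(I,C)\to(I',C')$ is a unital $*$-morphism $\rho:C\to C'$ such that $\rho(I)\subseteq I'$ and $\rho(J)$ is closed for every pre-isocone $J\subseteq I$. Let $\mathrm{ab}\text{-}\mathcal{IC}$ be the category of $I^*$-algebras $(I,C)$ with $C$ commutative, with $I^*$-morphisms. For a partially ordered topological space $M$ let $I(M)$ be the set of continuous isotone (order-preserving) functions $M\to\mathbb R$. $M$ is a *toposet* if for all $x,y\in M$: $x\le y$ if and only if $f(x)\le f(y)$ for all $f\in I(M)$. It is a *pospace* if $\{(x,y): x\le y\}$ is closed in $M\times M$. Let $\mathcal{KT}$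 be the category of compact toposets with continuous isotone maps. Let $\widehat{\ }$ be the contravariant functor from $\mathrm{ab}\text{-}\mathcal{IC}$ to $\mathcal{KT}$ given on objects by $(I,C)\mapsto(\hat C,\le_I)$, where $\hat C$ is the space of characters of $C$ with the weak-$*$ topology and $\varphi\le_I\psi$ iff $\varphi(c)\le\psi(c)$ for all $c\in I$, and on morphisms by $\rho\mapsto(\chi\mapsto\chi\circ\rho)$. Let $\mathcal I$ be the contravariant functor from $\mathcal{KT}$ to $\mathrm{ab}\text{-}\mathcal{IC}$ given by $M\mapsto(I(M),C(M))$, where $C(M)$ is the algebra of continuous functions $M\to\mathbb C$, and $f\mapsto(g\mapsto g\circ f)$. **Proposition.** The functors $\widehat{\ }$ and $\mathcal I$ realize a dual equivalence between $\mathrm{ab}\text{-}\mathcal{IC}$ and $\mathcal{KT}$: they are inverse to each other up to natural isomorphism. Here compact toposets are the same as compact pospaces: a compact partially ordered topological space is a toposet if and only if it is a pospace. This generalizes commutative Gelfand–Naimark duality, in the following sense. For every commutative unital $C^*$-algebra $C$, with $\mathrm{Re}\,C$ its set of hermitian elements, $(\mathrm{Re}\,C,C)$ is an $I^*$-algebra;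 for every object $(I,A)$ of $\mathrm{ab}\text{-}\mathcal{IC}$, every unital $*$-morphism $A\to C$ is an $I^*$-morphism $(I,A)\to(\mathrm{Re}\,C,C)$; and an object $(I,C)$ of $\mathrm{ab}\text{-}\mathcal{IC}$ satisfies $I=\mathrm{Re}\,C$ if and only if $\le_I$ is the trivial order (equality) on $\hat C$. -/

import Mathlib

open CategoryTheory WeakDual

universe u

noncomputable section

/-! ## Meet and join in a unital C⋆-algebra -/

/-- The modulus `|a| = √(a⋆ a)` in a unital C⋆-algebra (which is given its usual order, for which
the positive elements are those of the form `b⋆ b`). -/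
def cstarAbs {C : Type*} [CStarAlgebra C] (a : C) : C :=
  letI := CStarAlgebra.spectralOrder C
  haveI := CStarAlgebra.spectralOrderedRing C
  CFC.abs a

/-- `a ∧ b = (a + b) / 2 - |a - b| / 2`. -/
def cstarMeet {C : Type*} [CStarAlgebra C] (a b : C) : C :=
  (2⁻¹ : ℂ) • (a + b) - (2⁻¹ : ℂ) • cstarAbs (a - b)

/-- `a ∨ b = (a + b) / 2 + |a - b| / 2`. -/
def cstarJoin {C : Type*} [CStarAlgebra C] (a b : C) : C :=
  (2⁻¹ : ℂ) • (a + b) + (2⁻¹ : ℂ) • cstarAbs (a - b)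

/-! ## Isocones and I⋆-algebras -/

/-- A (strong) pre-isocone of a unital C⋆-algebra: a closed convex cone of hermitian elements,
containing the real constants and stable under `∧` and `∨`. -/
structure IsPreIsocone {C : Type*} [CStarAlgebra C] (I : Set C) : Prop where
  isSelfAdjoint : ∀ b ∈ I, IsSelfAdjoint b
  isClosed : IsClosed I
  add_mem : ∀ b ∈ I, ∀ b' ∈ I, b + b' ∈ I
  smul_mem : ∀ r : ℝ, 0 ≤ r → ∀ b ∈ I, (r : ℂ) • b ∈ I
  join_mem : ∀ b ∈ I, ∀ b' ∈ I, cstarJoin b b' ∈ I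
  meet_mem : ∀ b ∈ I, ∀ b' ∈ I, cstarMeet b b' ∈ I
  const_mem : ∀ x : ℝ, (x : ℂ) • (1 : C) ∈ I

/-- A (strong) isocone: a pre-isocone whose linear span is dense.  A (strong) I⋆-algebra is a unital
C⋆-algebra equipped with an isocone. -/
structure IsIsocone {C : Type*} [CStarAlgebra C] (I : Set C) : Prop extends IsPreIsocone I where
  dense_span : Dense (Submodule.span ℂ I : Set C)

/-- An I⋆-morphism `(I, C) → (I', C')` of (strong) I⋆-algebras: a (unital) ⋆-morphism `ρ : C → C'`
with `ρ(I) ⊆ I'` such that `ρ(J)` is closed for every pre-isocone `J ⊆ I`. -/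
@[ext]
structure IStarHom {C C' : Type*} [CStarAlgebra C] [CStarAlgebra C'] (I : Set C) (I' : Set C')
    extends C →⋆ₐ[ℂ] C' where
  map_mem' : ∀ a ∈ I, toStarAlgHom a ∈ I'
  isClosed_image' : ∀ J : Set C, IsPreIsocone J → J ⊆ I → IsClosed (toStarAlgHom '' J)

/-! ### Basic facts needed for the category structure -/

theorem cstarAbs_unique {C : Type*} [CStarAlgebra C] {a b c : C} (hb : b = star c * c)
    (h : b * b = star a * a) : cstarAbs a = b := by
  let := CStarAlgebra.spectralOrder C
  have := CStarAlgebra.spectralOrderedRing C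
  have hb0 : 0 ≤ b := hb ▸ star_mul_self_nonneg c
  change CFC.sqrt (star a * a) = b
  exact CFC.sqrt_unique h

theorem cstarAbs_spec {C : Type*} [CStarAlgebra C] (a : C) :
    (∃ c : C, cstarAbs a = star c * c) ∧ cstarAbs a * cstarAbs a = star a * a := by
  let := CStarAlgebra.spectralOrder C
  have := CStarAlgebra.spectralOrderedRing C
  exact ⟨CStarAlgebra.nonneg_iff_eq_star_mul_self.mp (CFC.abs_nonneg a), CFC.abs_mul_abs a⟩

theorem map_cstarAbs {C C' : Type*} [CStarAlgebra C] [CStarAlgebra C'] (ρ : C →⋆ₐ[ℂ] C') (a : C) :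
    ρ (cstarAbs a) = cstarAbs (ρ a) := by
  obtain ⟨⟨c, hc⟩, h⟩ := cstarAbs_spec a
  refine (cstarAbs_unique (c := ρ c) ?_ ?_).symm
  · rw [hc, map_mul, map_star]
  · rw [← map_mul, h, map_mul, map_star]

theorem map_cstarMeet {C C' : Type*} [CStarAlgebra C] [CStarAlgebra C'] (ρ : C →⋆ₐ[ℂ] C')
    (a b : C) : ρ (cstarMeet a b) = cstarMeet (ρ a) (ρ b) := by
  simp [cstarMeet, map_cstarAbs]

theorem map_cstarJoin {C C' : Type*} [CStarAlgebra C] [CStarAlgebra C'] (ρ : C →⋆ₐ[ℂ] C')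
    (a b : C) : ρ (cstarJoin a b) = cstarJoin (ρ a) (ρ b) := by
  simp [cstarJoin, map_cstarAbs]

theorem IsPreIsocone.image {C C' : Type*} [CStarAlgebra C] [CStarAlgebra C'] {J : Set C}
    (hJ : IsPreIsocone J) (ρ : C →⋆ₐ[ℂ] C') (hc : IsClosed (ρ '' J)) : IsPreIsocone (ρ '' J) where
  isSelfAdjoint := by
    rintro _ ⟨b, hb, rfl⟩
    exact (hJ.isSelfAdjoint b hb).map ρ
  isClosed := hc
  add_mem := by
    rintro _ ⟨b, hb, rfl⟩ _ ⟨b', hb', rfl⟩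
    exact ⟨_, hJ.add_mem b hb b' hb', map_add ρ b b'⟩
  smul_mem := by
    rintro r hr _ ⟨b, hb, rfl⟩
    exact ⟨_, hJ.smul_mem r hr b hb, map_smul ρ _ b⟩
  join_mem := by
    rintro _ ⟨b, hb, rfl⟩ _ ⟨b', hb', rfl⟩
    exact ⟨_, hJ.join_mem b hb b' hb', map_cstarJoin ρ b b'⟩
  meet_mem := by
    rintro _ ⟨b, hb, rfl⟩ _ ⟨b', hb', rfl⟩
    exact ⟨_, hJ.meet_mem b hb b' hb', map_cstarMeet ρ b b'⟩
  const_mem := fun x => ⟨_, hJ.const_mem x, by rw [map_smul, map_one]⟩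

namespace IStarHom

/-- The identity I⋆-morphism. -/
def id {C : Type*} [CStarAlgebra C] (I : Set C) : IStarHom I I where
  toStarAlgHom := StarAlgHom.id ℂ C
  map_mem' := fun _ ha => ha
  isClosed_image' := fun J hJ _ => by simpa using hJ.isClosed

/-- The composite `ρ' ∘ ρ` of I⋆-morphisms. -/
def comp {C C' C'' : Type*} [CStarAlgebra C] [CStarAlgebra C'] [CStarAlgebra C'']
    {I : Set C} {I' : Set C'} {I'' : Set C''} (ρ' : IStarHom I' I'') (ρ : IStarHom I I') :
    IStarHom I I'' where
  toStarAlgHom := ρ'.toStarAlgHom.comp ρ.toStarAlgHom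
  map_mem' := fun a ha => ρ'.map_mem' _ (ρ.map_mem' a ha)
  isClosed_image' := fun J hJ hJI => by
    have h := ρ'.isClosed_image' _ (hJ.image ρ.toStarAlgHom (ρ.isClosed_image' J hJ hJI)) (by
      rintro _ ⟨a, ha, rfl⟩
      exact ρ.map_mem' a (hJI ha))
    rw [Set.image_image] at h
    exact h

end IStarHom

/-- A commutative (unital, strong) I⋆-algebra `(I, C)`. -/
structure AbIC : Type (u + 1) where
  carrier : Type u
  [cstar : CommCStarAlgebra carrier]
  /-- the isocone `I` -/
  cone : Set carrier
  isIsocone : IsIsocone cone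

attribute [instance] AbIC.cstar

/-- The category of commutative I⋆-algebras and I⋆-morphisms. -/
instance : Category AbIC.{u} where
  Hom A B := IStarHom A.cone B.cone
  id A := IStarHom.id A.cone
  comp f g := IStarHom.comp g f

/-! ## Compact toposets -/

/-- A completely separated ordered space, or toposet: the continuous isotone real functions
determine the order. -/
def IsToposet (M : Type*) [TopologicalSpace M] [PartialOrder M] : Prop :=
  ∀ x y : M, x ≤ y ↔ ∀ f : M → ℝ, Continuous f → Monotone f → f x ≤ f y

/-- A compact toposet. -/
structure CompactToposet : Type (u + 1) where
  carrier : Type u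
  [top : TopologicalSpace carrier]
  [order : PartialOrder carrier]
  [compact : CompactSpace carrier]
  isToposet : IsToposet carrier

attribute [instance] CompactToposet.top CompactToposet.order CompactToposet.compact

/-- The category of compact toposets and continuous isotone maps. -/
instance : Category CompactToposet.{u} where
  Hom M N := M.carrier →Co N.carrier
  id M := ContinuousOrderHom.id M.carrier
  comp f g := ContinuousOrderHom.comp g f

/-! ## The functor `(I, C) ↦ (Ĉ, ≤_I)` -/

/-- The order `≤_I` on the character space `Ĉ`: `φ ≤ ψ` iff `φ c ≤ ψ c` for all `c ∈ I`
(characters take real values on hermitian elements, so that the real parts are the values). -/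
@[reducible] def charOrder {C : Type*} [CommCStarAlgebra C] {I : Set C} (hI : IsIsocone I) :
    PartialOrder (characterSpace ℂ C) where
  le φ ψ := ∀ c ∈ I, (φ c).re ≤ (ψ c).re
  le_refl _ _ _ := le_rfl
  le_trans _ _ _ h h' c hc := (h c hc).trans (h' c hc)
  le_antisymm φ ψ h h' := by
    have him : ∀ (χ : characterSpace ℂ C), ∀ c ∈ I, (χ c).im = 0 := fun χ c hc =>
      Complex.conj_eq_iff_im.mp ((hI.isSelfAdjoint c hc).map χ).star_eq
    have hE : Set.EqOn (CharacterSpace.toCLM φ) (CharacterSpace.toCLM ψ) I := fun c hc =>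
      Complex.ext (le_antisymm (h c hc) (h' c hc)) ((him φ c hc).trans (him ψ c hc).symm)
    have : CharacterSpace.toCLM φ = CharacterSpace.toCLM ψ :=
      ContinuousLinearMap.ext_on hI.dense_span hE
    exact CharacterSpace.ext fun c => DFunLike.congr_fun this c

/-- The compact toposet `(Ĉ, ≤_I)` of characters (with the weak-⋆ topology) of a commutative
I⋆-algebra `(I, C)`. -/
def AbIC.hatObj (A : AbIC.{u}) : CompactToposet.{u} :=
  letI := charOrder A.isIsocone
  { carrier := characterSpace ℂ A.carrier
    isToposet := fun φ ψ => by
      refine ⟨fun h f _ hf => hf h, fun h c hc => ?_⟩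
      refine h (fun χ => (χ c).re) ?_ fun χ χ' hχ => hχ c hc
      exact Complex.continuous_re.comp (gelfandTransform ℂ A.carrier c).continuous }

/-- The contravariant functor `^`, acting on objects by `(I, C) ↦ (Ĉ, ≤_I)` and on morphisms
by `ρ ↦ (χ ↦ χ ∘ ρ)`. -/
def AbIC.hat : AbIC.{u}ᵒᵖ ⥤ CompactToposet.{u} where
  obj A := A.unop.hatObj
  map {A B} ρ :=
    letI := charOrder A.unop.isIsocone
    letI := charOrder B.unop.isIsocone
    { toFun := CharacterSpace.compContinuousMap ρ.unop.toStarAlgHom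
      monotone' := fun _ _ h c hc => h _ (ρ.unop.map_mem' c hc)
      continuous_toFun := (CharacterSpace.compContinuousMap ρ.unop.toStarAlgHom).continuous }

/-! ## The functor `M ↦ (I(M), C(M))` -/

/-- The set `I(M)` of continuous isotone real functions, inside the C⋆-algebra `C(M)` of continuous
complex functions. -/
def isotoneCone (M : Type*) [TopologicalSpace M] [PartialOrder M] : Set C(M, ℂ) :=
  {f | (∀ x, (f x).im = 0) ∧ Monotone fun x => (f x).re}

theorem cstarAbs_apply {M : Type*} [TopologicalSpace M] [CompactSpace M] (f : C(M, ℂ)) (x : M) :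
    cstarAbs f x = (‖f x‖ : ℂ) := by
  let b : C(M, ℂ) := ⟨fun x => (‖f x‖ : ℂ), by fun_prop⟩
  let c : C(M, ℂ) := ⟨fun x => (√‖f x‖ : ℂ), by fun_prop⟩
  have h : cstarAbs f = b := by
    refine cstarAbs_unique (c := c) ?_ ?_
    · ext x
      simp only [b, c, ContinuousMap.coe_mk, ContinuousMap.mul_apply, ContinuousMap.star_apply,
        RCLike.star_def, Complex.conj_ofReal]
      rw [← Complex.ofReal_mul, Real.mul_self_sqrt (norm_nonneg _)]
    · ext x
      simp only [b, ContinuousMap.coe_mk, ContinuousMap.mul_apply, ContinuousMap.star_apply,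
        RCLike.star_def]
      rw [mul_comm (starRingEnd ℂ (f x)), Complex.mul_conj, Complex.normSq_eq_norm_sq]
      push_cast
      ring
  rw [h]
  rfl

theorem cstarMeet_apply {M : Type*} [TopologicalSpace M] [CompactSpace M] (f g : C(M, ℂ)) (x : M)
    (hf : (f x).im = 0) (hg : (g x).im = 0) :
    cstarMeet f g x = ((min (f x).re (g x).re : ℝ) : ℂ) := by
  obtain ⟨a, ha⟩ : ∃ a : ℝ, f x = a := ⟨(f x).re, Complex.ext rfl (by simpa using hf)⟩
  obtain ⟨b, hb⟩ : ∃ b : ℝ, g x = b := ⟨(g x).re, Complex.ext rfl (by simpa using hg)⟩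
  simp only [cstarMeet, ContinuousMap.sub_apply, ContinuousMap.smul_apply, ContinuousMap.add_apply,
    cstarAbs_apply, ha, hb, Complex.ofReal_re, smul_eq_mul]
  rw [← Complex.ofReal_sub, Complex.norm_real, Real.norm_eq_abs]
  rcases le_total a b with h | h
  · rw [abs_of_nonpos (by linarith), min_eq_left h]
    push_cast
    ring
  · rw [abs_of_nonneg (by linarith), min_eq_right h]
    push_cast
    ring

theorem cstarJoin_apply {M : Type*} [TopologicalSpace M] [CompactSpace M] (f g : C(M, ℂ)) (x : M)
    (hf : (f x).im = 0) (hg : (g x).im = 0) :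
    cstarJoin f g x = ((max (f x).re (g x).re : ℝ) : ℂ) := by
  obtain ⟨a, ha⟩ : ∃ a : ℝ, f x = a := ⟨(f x).re, Complex.ext rfl (by simpa using hf)⟩
  obtain ⟨b, hb⟩ : ∃ b : ℝ, g x = b := ⟨(g x).re, Complex.ext rfl (by simpa using hg)⟩
  simp only [cstarJoin, ContinuousMap.smul_apply, ContinuousMap.add_apply,
    ContinuousMap.sub_apply, cstarAbs_apply, ha, hb, Complex.ofReal_re, smul_eq_mul]
  rw [← Complex.ofReal_sub, Complex.norm_real, Real.norm_eq_abs]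
  rcases le_total a b with h | h
  · rw [abs_of_nonpos (by linarith), max_eq_right h]
    push_cast
    ring
  · rw [abs_of_nonneg (by linarith), max_eq_left h]
    push_cast
    ring

theorem isPreIsocone_isotoneCone (M : Type*) [TopologicalSpace M] [PartialOrder M]
    [CompactSpace M] : IsPreIsocone (isotoneCone M) where
  isSelfAdjoint f hf := by
    ext x
    exact Complex.conj_eq_iff_im.mpr (hf.1 x)
  isClosed := by
    have h1 : IsClosed (⋂ x : M, {f : C(M, ℂ) | (f x).im = 0}) :=
      isClosed_iInter fun x => isClosed_eq
        (Complex.continuous_im.comp (continuous_eval_const x)) continuous_const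
    have h2 : IsClosed (⋂ x : M, ⋂ y : M, ⋂ _ : x ≤ y, {f : C(M, ℂ) | (f x).re ≤ (f y).re}) :=
      isClosed_iInter fun x => isClosed_iInter fun y => isClosed_iInter fun _ => isClosed_le
        (Complex.continuous_re.comp (continuous_eval_const x))
        (Complex.continuous_re.comp (continuous_eval_const y))
    have h : isotoneCone M = (⋂ x : M, {f : C(M, ℂ) | (f x).im = 0}) ∩
        ⋂ x : M, ⋂ y : M, ⋂ _ : x ≤ y, {f : C(M, ℂ) | (f x).re ≤ (f y).re} := by
      refine Set.ext fun f => ⟨fun hf => ⟨Set.mem_iInter.mpr hf.1, ?_⟩, fun hf => ⟨?_, ?_⟩⟩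
      · exact Set.mem_iInter.mpr fun x => Set.mem_iInter.mpr fun y => Set.mem_iInter.mpr
          fun h => hf.2 h
      · exact fun x => Set.mem_iInter.mp hf.1 x
      · exact fun x y h => Set.mem_iInter.mp (Set.mem_iInter.mp (Set.mem_iInter.mp hf.2 x) y) h
    rw [h]
    exact h1.inter h2
  add_mem f hf g hg :=
    ⟨fun x => by simp [hf.1 x, hg.1 x], fun x y h => by simpa using add_le_add (hf.2 h) (hg.2 h)⟩
  smul_mem r hr f hf :=
    ⟨fun x => by simp [hf.1 x],
      fun x y h => by simpa using mul_le_mul_of_nonneg_left (hf.2 h) hr⟩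
  join_mem f hf g hg := by
    refine ⟨fun x => ?_, fun x y h => ?_⟩
    · rw [cstarJoin_apply f g x (hf.1 x) (hg.1 x), Complex.ofReal_im]
    · simp only [cstarJoin_apply f g _ (hf.1 _) (hg.1 _), Complex.ofReal_re]
      exact max_le_max (hf.2 h) (hg.2 h)
  meet_mem f hf g hg := by
    refine ⟨fun x => ?_, fun x y h => ?_⟩
    · rw [cstarMeet_apply f g x (hf.1 x) (hg.1 x), Complex.ofReal_im]
    · simp only [cstarMeet_apply f g _ (hf.1 _) (hg.1 _), Complex.ofReal_re]
      exact min_le_min (hf.2 h) (hg.2 h)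
  const_mem r := ⟨fun x => by simp, fun x y h => by simp⟩

theorem isIsocone_isotoneCone {M : Type*} [TopologicalSpace M] [PartialOrder M] [CompactSpace M]
    (hM : IsToposet M) : IsIsocone (isotoneCone M) where
  toIsPreIsocone := isPreIsocone_isotoneCone M
  dense_span := by
    have hI := isPreIsocone_isotoneCone M
    -- the nonnegative isotone functions form a submonoid of the multiplicative monoid
    let S : Submonoid C(M, ℂ) :=
      { carrier := {f | f ∈ isotoneCone M ∧ ∀ x, 0 ≤ (f x).re}
        one_mem' := ⟨by simpa using hI.const_mem 1, fun x => by simp⟩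
        mul_mem' := by
          rintro f g ⟨hf, hf0⟩ ⟨hg, hg0⟩
          refine ⟨⟨fun x => by simp [hf.1 x, hg.1 x], fun x y h => ?_⟩, fun x => ?_⟩
          · simpa [hf.1, hg.1] using mul_le_mul (hf.2 h) (hg.2 h) (hg0 x) (hf0 y)
          · simpa [hf.1, hg.1] using mul_nonneg (hf0 x) (hg0 x) }
    have hspan : Subalgebra.toSubmodule (Algebra.adjoin ℂ (S : Set C(M, ℂ)))
        = Submodule.span ℂ (S : Set C(M, ℂ)) := by
      rw [Algebra.adjoin_eq_span, Submonoid.closure_eq]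
    let R : StarSubalgebra ℂ C(M, ℂ) :=
      { toSubalgebra := Algebra.adjoin ℂ (S : Set C(M, ℂ))
        star_mem' := by
          intro a ha
          induction ha using Algebra.adjoin_induction with
          | mem f hf =>
            have : star f = f := hI.isSelfAdjoint f hf.1
            rw [this]
            exact Algebra.subset_adjoin hf
          | algebraMap r =>
            rw [← algebraMap_star_comm]
            exact Subalgebra.algebraMap_mem _ _
          | add f g _ _ hf hg =>
            rw [star_add]
            exact Subalgebra.add_mem _ hf hg
          | mul f g _ _ hf hg =>
            rw [star_mul]
            exact Subalgebra.mul_mem _ hg hf }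
    have hsep : R.SeparatesPoints := by
      intro x y hxy
      obtain ⟨f, hfc, hfm, hfxy⟩ : ∃ f : M → ℝ, Continuous f ∧ Monotone f ∧ f x ≠ f y := by
        by_contra! h
        exact hxy (le_antisymm ((hM x y).2 fun f hc hm => (h f hc hm).le)
          ((hM y x).2 fun f hc hm => (h f hc hm).ge))
      obtain ⟨c, hc⟩ : ∃ c : ℝ, ∀ z, c ≤ f z := by
        obtain ⟨c, hc⟩ := (isCompact_range hfc).bddBelow
        exact ⟨c, fun z => hc ⟨z, rfl⟩⟩
      let g : C(M, ℂ) := ⟨fun z => ((f z - c : ℝ) : ℂ), by fun_prop⟩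
      refine ⟨g, ⟨g, Algebra.subset_adjoin ⟨⟨fun z => Complex.ofReal_im _, fun z w h => ?_⟩,
        fun z => ?_⟩, rfl⟩, ?_⟩
      · simpa [g] using hfm h
      · simpa [g] using hc z
      · simpa [g] using hfxy
    have htop := ContinuousMap.starSubalgebra_topologicalClosure_eq_top_of_separatesPoints R hsep
    have hdense : Dense (Submodule.span ℂ (S : Set C(M, ℂ)) : Set C(M, ℂ)) := by
      rw [← hspan]
      intro f
      have : f ∈ R.topologicalClosure := htop ▸ StarSubalgebra.mem_top
      exact this
    exact hdense.mono (Submodule.span_mono fun f hf => hf.1)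

/-- The commutative I⋆-algebra `(I(M), C(M))` of a compact toposet `M`. -/
def CompactToposet.isotoneObj (M : CompactToposet.{u}) : AbIC.{u} where
  carrier := C(M.carrier, ℂ)
  cone := isotoneCone M.carrier
  isIsocone := isIsocone_isotoneCone M.isToposet

/-- The truncation `(a ∨ (b - ε)) ∧ (b + ε)`. -/
def cstarTrunc {C : Type*} [CStarAlgebra C] (ε : ℝ) (a b : C) : C :=
  cstarMeet (cstarJoin a (b + ((-ε : ℝ) : ℂ) • 1)) (b + (ε : ℂ) • 1)

theorem cstarTrunc_apply {M : Type*} [TopologicalSpace M] [CompactSpace M] (ε : ℝ) (f g : C(M, ℂ))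
    (x : M) (hf : (f x).im = 0) (hg : (g x).im = 0) : cstarTrunc ε f g x =
      ((min (max (f x).re ((g x).re - ε)) ((g x).re + ε) : ℝ) : ℂ) := by
  have h1 : ∀ r : ℝ, ((g + (r : ℂ) • 1) x).im = 0 := fun r => by simp [hg]
  have h2 := cstarJoin_apply f (g + ((-ε : ℝ) : ℂ) • 1) x hf (h1 _)
  rw [cstarTrunc, cstarMeet_apply _ _ x (by rw [h2, Complex.ofReal_im]) (h1 _), h2]
  simp [sub_eq_add_neg]

theorem isClosed_image_comp {M N : Type*} [TopologicalSpace M] [CompactSpace M]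
    [TopologicalSpace N] [CompactSpace N] (f : C(M, N)) {J : Set C(N, ℂ)} (hJ : IsPreIsocone J) :
    IsClosed (f.compStarAlgHom' ℂ ℂ '' J) := by
  set ρ := f.compStarAlgHom' ℂ ℂ with hρ
  have him : ∀ a ∈ J, ∀ x, (a x).im = 0 := fun a ha x =>
    Complex.conj_eq_iff_im.mp (DFunLike.congr_fun (hJ.isSelfAdjoint a ha).star_eq x)
  have htr : ∀ ε : ℝ, ∀ a ∈ J, ∀ b ∈ J, cstarTrunc ε a b ∈ J := fun ε a ha b hb =>
    hJ.meet_mem _ (hJ.join_mem _ ha _ (hJ.add_mem _ hb _ (hJ.const_mem _))) _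
      (hJ.add_mem _ hb _ (hJ.const_mem _))
  have hre : ∀ a ∈ J, ∀ x, a x = ((a x).re : ℂ) := fun a ha x =>
    Complex.ext rfl (by simpa using him a ha x)
  have hdist : ∀ ε : ℝ, 0 ≤ ε → ∀ a ∈ J, ∀ b ∈ J, dist b (cstarTrunc ε a b) ≤ ε := by
    intro ε hε a ha b hb
    rw [ContinuousMap.dist_le hε]
    intro x
    rw [cstarTrunc_apply ε a b x (him a ha x) (him b hb x), hre b hb x, Complex.ofReal_re,
      dist_eq_norm, ← Complex.ofReal_sub, Complex.norm_real, Real.norm_eq_abs, abs_le]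
    constructor
    · linarith [min_le_right (max (a x).re ((b x).re - ε)) ((b x).re + ε)]
    · have : (b x).re - ε ≤ min (max (a x).re ((b x).re - ε)) ((b x).re + ε) :=
        le_min (le_max_right _ _) (by linarith)
      linarith
  have hfix : ∀ ε : ℝ, ∀ a ∈ J, ∀ b ∈ J, dist (ρ b) (ρ a) ≤ ε →
      ρ (cstarTrunc ε a b) = ρ a := by
    intro ε a ha b hb h
    ext x
    have hx : dist (b (f x)) (a (f x)) ≤ ε := (ContinuousMap.dist_apply_le_dist x).trans h
    rw [hre b hb, hre a ha, dist_eq_norm, ← Complex.ofReal_sub, Complex.norm_real,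
      Real.norm_eq_abs, abs_le] at hx
    change cstarTrunc ε a b (f x) = a (f x)
    rw [cstarTrunc_apply ε a b (f x) (him a ha _) (him b hb _), hre a ha (f x), Complex.ofReal_re,
      max_eq_left (by linarith), min_eq_left (by linarith)]
  refine isClosed_of_closure_subset fun h hh => ?_
  have happ : ∀ n : ℕ, ∃ a ∈ J, dist (ρ a) h < (1 / 2) ^ n / 2 := by
    intro n
    obtain ⟨_, ⟨a, ha, rfl⟩, hd⟩ := Metric.mem_closure_iff.mp hh ((1 / 2) ^ n / 2) (by positivity)
    exact ⟨a, ha, by rwa [dist_comm]⟩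
  choose a haJ had using happ
  let b : ℕ → C(N, ℂ) := fun n =>
    Nat.rec (a 0) (fun n b => cstarTrunc ((1 / 2) ^ n) (a (n + 1)) b) n
  have hb0 : b 0 = a 0 := rfl
  have hbs : ∀ n, b (n + 1) = cstarTrunc ((1 / 2) ^ n) (a (n + 1)) (b n) := fun _ => rfl
  have hb : ∀ n, b n ∈ J ∧ ρ (b n) = ρ (a n) := by
    intro n
    induction n with
    | zero => exact ⟨haJ 0, rfl⟩
    | succ n ih =>
      refine ⟨htr _ _ (haJ _) _ ih.1, ?_⟩
      rw [hbs]
      refine hfix _ _ (haJ _) _ ih.1 ?_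
      rw [ih.2]
      have h1 := had n
      have h2 := had (n + 1)
      have h3 : ((1 / 2 : ℝ)) ^ (n + 1) ≤ (1 / 2) ^ n :=
        pow_le_pow_of_le_one (by norm_num) (by norm_num) (Nat.le_succ n)
      linarith [dist_triangle_right (ρ (a n)) (ρ (a (n + 1))) h]
  have hcauchy : CauchySeq b := by
    refine cauchySeq_of_le_geometric (1 / 2) 1 (by norm_num) fun n => ?_
    rw [one_mul, hbs]
    exact hdist _ (by positivity) _ (haJ _) _ (hb n).1
  obtain ⟨c, hc⟩ := cauchySeq_tendsto_of_complete hcauchy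
  refine ⟨c, hJ.isClosed.mem_of_tendsto hc (Filter.Eventually.of_forall fun n => (hb n).1), ?_⟩
  have hρc : Continuous ρ := ContinuousMap.continuous_precomp f
  have h1 := (hρc.tendsto c).comp hc
  refine tendsto_nhds_unique h1 (tendsto_iff_dist_tendsto_zero.mpr ?_)
  refine squeeze_zero (fun _ => dist_nonneg) (g := fun n : ℕ => (1 / 2 : ℝ) ^ n) (fun n => ?_)
    (tendsto_pow_atTop_nhds_zero_of_lt_one (by norm_num) (by norm_num))
  change dist (ρ (b n)) h ≤ _
  rw [(hb n).2]
  have : (0 : ℝ) < (1 / 2) ^ n := by positivity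
  linarith [had n]

/-- The contravariant functor `𝓘`, acting on objects by `M ↦ (I(M), C(M))` and on morphisms by
`f ↦ (g ↦ g ∘ f)`. -/
def CompactToposet.isotone : CompactToposet.{u}ᵒᵖ ⥤ AbIC.{u} where
  obj M := M.unop.isotoneObj
  map {M N} f :=
    { toStarAlgHom := (f.unop.toContinuousMap).compStarAlgHom' ℂ ℂ
      map_mem' := fun _ hg => ⟨fun x => hg.1 _, fun _ _ h => hg.2 (f.unop.monotone' h)⟩
      isClosed_image' := fun _ hJ _ => isClosed_image_comp _ hJ }

end

/-!
Forgetting orders and cones, the duality is commutative Gelfand duality, with the Gelfand transform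
`C → C(Ĉ)` and evaluation at points `M → characters of C(M)` as natural isomorphisms. What remains
is to see that these isomorphisms respect the order structure in both directions.

* For a compact toposet `M`, evaluation is an order isomorphism onto the characters because the
  continuous isotone functions determine the order of `M`, by definition.
* For an isocone `I` of `C`, the Gelfand transform must carry `I` onto *all* real isotone functions
  on `(Ĉ, ≤_I)` (`gelfandStarTransform_mem_isotoneCone_iff`). The image of `I` is a closed sublattice
  of the real continuous functions, and it interpolates any isotone `f` at any two points: constants
  do so when `f` takes equal values there, and otherwise the definition of `≤_I` gives an element of
  `I` separating the points in the same direction as `f`, to be rescaled and shifted. The lattice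
  form of the Stone-Weierstrass theorem (`mem_closure_of_interpolation`) concludes.

The same description of `I` shows that `I` consists of all hermitian elements exactly when `≤_I` is
trivial. The closed range condition on morphisms is automatic in the commutative case, since every
⋆-morphism is, up to Gelfand transforms, composition with a continuous map
(`isClosed_image_starAlgHom`).

That a compact pospace is a toposet is Nachbin's theorem: if `¬ x ≤ y`, the closed lower set
`Iic y` and the closed upper set `Ici x` are disjoint, and an ordered version of Urysohn's lemma
(`exists_continuous_monotone_zero_one`) separates them by an isotone function. The interpolating
lower sets exist because in a compact pospace the lower and upper closures of closed sets are
closed.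
-/

/-! ### Compact pospaces -/

theorem isClosed_upperClosure_of_compactSpace {M : Type*} [TopologicalSpace M] [PartialOrder M]
    [CompactSpace M] [OrderClosedTopology M] {s : Set M} (hs : IsClosed s) :
    IsClosed (upperClosure s : Set M) := by
  have h : (upperClosure s : Set M) = Prod.snd '' ({p : M × M | p.1 ≤ p.2} ∩ Prod.fst ⁻¹' s) := by
    ext y
    simp only [SetLike.mem_coe, mem_upperClosure, Set.mem_image, Set.mem_inter_iff]
    exact ⟨fun ⟨x, hx, hxy⟩ => ⟨(x, y), ⟨hxy, hx⟩, rfl⟩,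
      fun ⟨p, ⟨hp, hps⟩, hy⟩ => ⟨p.1, hps, hy ▸ hp⟩⟩
  rw [h]
  exact isClosedMap_snd_of_compactSpace _
    (OrderClosedTopology.isClosed_le'.inter (hs.preimage continuous_fst))

theorem isClosed_lowerClosure_of_compactSpace {M : Type*} [TopologicalSpace M] [PartialOrder M]
    [CompactSpace M] [OrderClosedTopology M] {s : Set M} (hs : IsClosed s) :
    IsClosed (lowerClosure s : Set M) :=
  have : CompactSpace Mᵒᵈ := inferInstanceAs (CompactSpace M)
  isClosed_upperClosure_of_compactSpace (M := Mᵒᵈ) hs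

/-- Between a closed lower set and an open lower set containing it one can insert an open lower set
and a closed lower set: this is the interpolation step of the ordered Urysohn lemma. -/
theorem exists_isLowerSet_between {M : Type*} [TopologicalSpace M] [PartialOrder M]
    [CompactSpace M] [OrderClosedTopology M] {s u : Set M} (hs : IsClosed s) (hsl : IsLowerSet s)
    (hu : IsOpen u) (hul : IsLowerSet u) (hsu : s ⊆ u) :
    ∃ v d : Set M, IsOpen v ∧ IsLowerSet v ∧ IsClosed d ∧ IsLowerSet d ∧
      s ⊆ v ∧ v ⊆ d ∧ d ⊆ u := by
  obtain ⟨w, hw, hsw, hwu⟩ := normal_exists_closure_subset hs hu hsu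
  refine ⟨(upperClosure wᶜ : Set M)ᶜ, lowerClosure (closure w),
    (isClosed_upperClosure_of_compactSpace hw.isClosed_compl).isOpen_compl,
    (upperClosure wᶜ).upper.compl, isClosed_lowerClosure_of_compactSpace isClosed_closure,
    (lowerClosure _).lower, fun x hx hx' => ?_, fun x hx => ?_, lowerClosure_min hwu hul⟩
  · obtain ⟨y, hy, hyx⟩ := mem_upperClosure.1 hx'
    exact hy (hsw (hsl hyx hx))
  · by_contra hxd
    exact hx (subset_upperClosure fun hxw => hxd (subset_lowerClosure (subset_closure hxw)))

/-- If all the open sets occurring in the Urysohn construction are lower sets, then the resulting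
function is isotone: it is a supremum of iterated averages of indicators of complements of such
sets. -/
theorem Urysohns.CU.monotone_lim {M : Type*} [TopologicalSpace M] [Preorder M]
    {P : Set M → Set M → Prop} (hP : ∀ s u, P s u → IsLowerSet u) (c : Urysohns.CU P) :
    Monotone c.lim := by
  have happrox : ∀ n (c : Urysohns.CU P), Monotone (c.approx n) := by
    intro n
    induction n with
    | zero =>
      intro c x y hxy
      by_cases hy : y ∈ c.U
      · have hx : x ∈ c.U := hP _ _ c.P_C_U hxy hy
        simp [Urysohns.CU.approx, hx, hy]
      · rw [c.approx_of_notMem_U 0 hy]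
        exact c.approx_le_one 0 x
    | succ n ih => exact fun c x y hxy => midpoint_le_midpoint (ih c.left hxy) (ih c.right hxy)
  exact fun x y hxy => ciSup_mono (c.bddAbove_range_approx y) fun n => happrox n c hxy

/-- Nachbin's ordered form of Urysohn's lemma. -/
theorem exists_continuous_monotone_zero_one {M : Type*} [TopologicalSpace M] [PartialOrder M]
    [CompactSpace M] [OrderClosedTopology M] {s t : Set M} (hs : IsClosed s) (hsl : IsLowerSet s)
    (ht : IsClosed t) (htu : IsUpperSet t) (hst : Disjoint s t) :
    ∃ f : M → ℝ, Continuous f ∧ Monotone f ∧ (∀ x ∈ s, f x = 0) ∧ ∀ x ∈ t, f x = 1 := by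
  -- The inner closed sets of Mathlib's construction are closures, which need not be lower sets:
  -- it suffices that they are separated from the outer open set by a closed lower set.
  let c : Urysohns.CU fun s u : Set M =>
      IsLowerSet u ∧ ∃ d, IsClosed d ∧ IsLowerSet d ∧ s ⊆ d ∧ d ⊆ u :=
    { C := s
      U := tᶜ
      P_C_U := ⟨htu.compl, s, hs, hsl, subset_rfl, hst.subset_compl_right⟩
      closed_C := hs
      open_U := ht.isOpen_compl
      subset := hst.subset_compl_right
      hP := by
        rintro a u - ⟨hul, d, hd, hdl, had, hdu⟩ hu -
        obtain ⟨v, e, hv, hvl, he, hel, hdv, hve, heu⟩ := exists_isLowerSet_between hd hdl hu hul hdu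
        have hcl : closure v ⊆ e := closure_minimal hve he
        exact ⟨v, hv, had.trans hdv, hcl.trans heu, ⟨hvl, d, hd, hdl, had, hdv⟩,
          hul, e, he, hel, hcl, heu⟩ }
  exact ⟨c.lim, c.continuous_lim, Urysohns.CU.monotone_lim (fun _ _ h => h.1) c,
    c.lim_of_mem_C, fun x hx => c.lim_of_notMem_U x (not_not_intro hx)⟩

theorem IsToposet.isClosed_le {M : Type*} [TopologicalSpace M] [PartialOrder M]
    (hM : IsToposet M) : IsClosed {p : M × M | p.1 ≤ p.2} := by
  have h : {p : M × M | p.1 ≤ p.2} =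
      ⋂ (f : M → ℝ) (_ : Continuous f) (_ : Monotone f), {p | f p.1 ≤ f p.2} := by
    ext p
    simpa using hM p.1 p.2
  rw [h]
  exact isClosed_iInter fun f => isClosed_iInter fun hf => isClosed_iInter fun _ =>
    _root_.isClosed_le (hf.comp continuous_fst) (hf.comp continuous_snd)

theorem isToposet_iff_isClosed_le {M : Type*} [TopologicalSpace M] [PartialOrder M]
    [CompactSpace M] : IsToposet M ↔ IsClosed {p : M × M | p.1 ≤ p.2} := by
  refine ⟨IsToposet.isClosed_le, fun h x y => ⟨fun hxy f _ hf => hf hxy, fun hxy => ?_⟩⟩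
  have : OrderClosedTopology M := ⟨h⟩
  by_contra hn
  obtain ⟨f, hfc, hfm, hf0, hf1⟩ := exists_continuous_monotone_zero_one (isClosed_Iic (a := y))
    (isLowerSet_Iic y) (isClosed_Ici (a := x)) (isUpperSet_Ici x)
    (Set.disjoint_left.2 fun z hzy hxz => hn (le_trans hxz hzy))
  have := hxy f hfc hfm
  rw [hf0 y le_rfl, hf1 x le_rfl] at this
  exact absurd this (by norm_num)

theorem IsToposet.t2Space {M : Type*} [TopologicalSpace M] [PartialOrder M] (hM : IsToposet M) :
    T2Space M :=
  have : OrderClosedTopology M := ⟨hM.isClosed_le⟩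
  inferInstance

/-! ### Lattice approximation by isotone functions -/

/-- The lattice form of the Stone-Weierstrass theorem, for a single function: if `f` can be
interpolated at any two points by elements of a sublattice `L` of `C(X, ℝ)`, then it lies in the
closure of `L`. -/
theorem mem_closure_of_interpolation {X : Type*} [TopologicalSpace X] [CompactSpace X]
    {L : Set C(X, ℝ)} (hL : L.Nonempty) (hinf : ∀ g ∈ L, ∀ h ∈ L, g ⊓ h ∈ L)
    (hsup : ∀ g ∈ L, ∀ h ∈ L, g ⊔ h ∈ L) {f : C(X, ℝ)}
    (hf : ∀ x y, ∃ g ∈ L, g x = f x ∧ g y = f y) : f ∈ closure L := by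
  refine Metric.mem_closure_iff.2 fun ε hε => ?_
  have hlower : ∀ x, ∃ g ∈ L, g x = f x ∧ ∀ z ∈ Set.univ, f z - ε < g z := by
    intro x
    refine isCompact_univ.induction_on
      (p := fun s => ∃ g ∈ L, g x = f x ∧ ∀ z ∈ s, f z - ε < g z) ?_ ?_ ?_ ?_
    · obtain ⟨g, hg, hgx, -⟩ := hf x x
      exact ⟨g, hg, hgx, by simp⟩
    · rintro s t hst ⟨g, hg, hgx, hgt⟩
      exact ⟨g, hg, hgx, fun z hz => hgt z (hst hz)⟩
    · rintro s t ⟨g, hg, hgx, hgs⟩ ⟨h, hh, hhx, hht⟩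
      refine ⟨g ⊔ h, hsup g hg h hh, by simp [hgx, hhx], ?_⟩
      rintro z (hz | hz)
      · exact lt_sup_of_lt_left (hgs z hz)
      · exact lt_sup_of_lt_right (hht z hz)
    · intro y _
      obtain ⟨g, hg, hgx, hgy⟩ := hf x y
      exact ⟨{z | f z - ε < g z}, mem_nhdsWithin_of_mem_nhds
        ((isOpen_lt (by fun_prop) (by fun_prop)).mem_nhds (by simp [hgy, hε])),
        g, hg, hgx, fun z hz => hz⟩
  have hboth : ∃ g ∈ L, (∀ z, f z - ε < g z) ∧ ∀ z ∈ Set.univ, g z < f z + ε := by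
    refine isCompact_univ.induction_on
      (p := fun s => ∃ g ∈ L, (∀ z, f z - ε < g z) ∧ ∀ z ∈ s, g z < f z + ε) ?_ ?_ ?_ ?_
    · rcases isEmpty_or_nonempty X with hX | ⟨⟨x⟩⟩
      · obtain ⟨g, hg⟩ := hL
        exact ⟨g, hg, fun z => hX.elim z, by simp⟩
      · obtain ⟨g, hg, -, h⟩ := hlower x
        exact ⟨g, hg, fun z => h z trivial, by simp⟩
    · rintro s t hst ⟨g, hg, hgl, hgt⟩
      exact ⟨g, hg, hgl, fun z hz => hgt z (hst hz)⟩
    · rintro s t ⟨g, hg, hgl, hgs⟩ ⟨h, hh, hhl, hht⟩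
      refine ⟨g ⊓ h, hinf g hg h hh, fun z => lt_inf_iff.2 ⟨hgl z, hhl z⟩, ?_⟩
      rintro z (hz | hz)
      · exact inf_lt_of_left_lt (hgs z hz)
      · exact inf_lt_of_right_lt (hht z hz)
    · intro x _
      obtain ⟨g, hg, hgx, h⟩ := hlower x
      exact ⟨{z | g z < f z + ε}, mem_nhdsWithin_of_mem_nhds
        ((isOpen_lt (by fun_prop) (by fun_prop)).mem_nhds (by simp [hgx, hε])),
        g, hg, fun z => h z trivial, fun z hz => hz⟩
  obtain ⟨g, hg, h1, h2⟩ := hboth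
  refine ⟨g, hg, (ContinuousMap.dist_lt_iff hε).2 fun z => ?_⟩
  rw [Real.dist_eq, abs_lt]
  constructor <;> linarith [h1 z, h2 z trivial]

theorem IsPreIsocone.im_apply {X : Type*} [TopologicalSpace X] [CompactSpace X]
    {J : Set C(X, ℂ)} (hJ : IsPreIsocone J) {g : C(X, ℂ)} (hg : g ∈ J) (x : X) :
    (g x).im = 0 :=
  Complex.conj_eq_iff_im.mp (DFunLike.congr_fun (hJ.isSelfAdjoint g hg).star_eq x)

/-- A pre-isocone `J` of `C(X)` contains every real function which is isotone for the preorder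
defined by `J`. If `f x < f y`, then some `g ∈ J` has `g x < g y`, and an affine function of `g`
with positive slope interpolates `f` at `x` and `y`. -/
theorem IsPreIsocone.mem_of_isotone {X : Type*} [TopologicalSpace X] [CompactSpace X]
    {J : Set C(X, ℂ)} (hJ : IsPreIsocone J) {f : C(X, ℂ)} (hf : ∀ x, (f x).im = 0)
    (hmono : ∀ x y, (∀ g ∈ J, (g x).re ≤ (g y).re) → (f x).re ≤ (f y).re) : f ∈ J := by
  let ofR : C(X, ℝ) → C(X, ℂ) := fun g => (⟨_, Complex.continuous_ofReal⟩ : C(ℝ, ℂ)).comp g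
  have hofR : Continuous ofR := ContinuousMap.continuous_postcomp _
  let L : Set C(X, ℝ) := ofR ⁻¹' J
  have hinterp : ∀ x y, (f x).re < (f y).re → ∃ g ∈ L, g x = (f x).re ∧ g y = (f y).re := by
    intro x y hxy
    obtain ⟨g, hg, hgxy⟩ : ∃ g ∈ J, (g x).re < (g y).re := by
      by_contra! h
      exact absurd (hmono y x h) (not_le.2 hxy)
    have hg0 : (g y).re - (g x).re ≠ 0 := (sub_pos.2 hgxy).ne'
    let r := ((f y).re - (f x).re) / ((g y).re - (g x).re)
    have hr : 0 ≤ r := div_nonneg (sub_pos.2 hxy).le (sub_pos.2 hgxy).le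
    let k : C(X, ℝ) := ⟨fun z => r * (g z).re + ((f x).re - r * (g x).re), by fun_prop⟩
    refine ⟨k, ?_, ?_, ?_⟩
    · have hk : ofR k = (r : ℂ) • g + (((f x).re - r * (g x).re : ℝ) : ℂ) • 1 := by
        ext z
        apply Complex.ext <;> simp [ofR, k, hJ.im_apply hg z]
      change ofR k ∈ J
      rw [hk]
      exact hJ.add_mem _ (hJ.smul_mem r hr g hg) _ (hJ.const_mem _)
    · simp [k]
    · simp only [k, r, ContinuousMap.coe_mk]
      field_simp
      ring
  have hconst : ∀ r : ℝ, ContinuousMap.const X r ∈ L := by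
    intro r
    have hr : ofR (ContinuousMap.const X r) = (r : ℂ) • 1 := by
      ext z
      simp [ofR]
    change ofR _ ∈ J
    rw [hr]
    exact hJ.const_mem r
  let fr : C(X, ℝ) := ⟨fun x => (f x).re, by fun_prop⟩
  have hmem : fr ∈ closure L := by
    refine mem_closure_of_interpolation ⟨_, hconst 0⟩ (fun g hg h hh => ?_) (fun g hg h hh => ?_)
      fun x y => ?_
    · have : ofR (g ⊓ h) = cstarMeet (ofR g) (ofR h) := by
        ext z
        rw [cstarMeet_apply _ _ z (by simp [ofR]) (by simp [ofR])]
        simp [ofR]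
      change ofR _ ∈ J
      rw [this]
      exact hJ.meet_mem _ hg _ hh
    · have : ofR (g ⊔ h) = cstarJoin (ofR g) (ofR h) := by
        ext z
        rw [cstarJoin_apply _ _ z (by simp [ofR]) (by simp [ofR])]
        simp [ofR]
      change ofR _ ∈ J
      rw [this]
      exact hJ.join_mem _ hg _ hh
    · rcases lt_trichotomy (f x).re (f y).re with h | h | h
      · exact hinterp x y h
      · exact ⟨_, hconst (f x).re, rfl, h⟩
      · obtain ⟨g, hg, hy, hx⟩ := hinterp y x h
        exact ⟨g, hg, hx, hy⟩
  rw [(hJ.isClosed.preimage hofR).closure_eq] at hmem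
  have hfr : ofR fr = f := by
    ext x
    exact Complex.ext (by simp [ofR, fr]) (by simp [ofR, hf x])
  exact hfr ▸ hmem

/-! ### Isocones under the Gelfand transform -/

theorem isSelfAdjoint_cstarAbs {C : Type*} [CStarAlgebra C] (a : C) :
    IsSelfAdjoint (cstarAbs a) := by
  obtain ⟨⟨c, hc⟩, -⟩ := cstarAbs_spec a
  exact hc ▸ IsSelfAdjoint.star_mul_self c

theorem isIsocone_setOf_isSelfAdjoint (C : Type*) [CStarAlgebra C] :
    IsIsocone {a : C | IsSelfAdjoint a} := by
  have hreal : ∀ r : ℝ, IsSelfAdjoint (r : ℂ) := fun r => Complex.conj_ofReal r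
  have hhalf : IsSelfAdjoint (2⁻¹ : ℂ) := by simp [IsSelfAdjoint]
  exact
    { isSelfAdjoint := fun _ hb => hb
      isClosed := isClosed_eq continuous_star continuous_id
      add_mem := fun _ hb _ hb' => hb.add hb'
      smul_mem := fun r _ _ hb => (hreal r).smul hb
      join_mem := fun b hb b' hb' =>
        (hhalf.smul (hb.add hb')).add (hhalf.smul (isSelfAdjoint_cstarAbs _))
      meet_mem := fun b hb b' hb' =>
        (hhalf.smul (hb.add hb')).sub (hhalf.smul (isSelfAdjoint_cstarAbs _))
      const_mem := fun r => (hreal r).smul (.one C)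
      dense_span := by
        have h : Submodule.span ℂ {a : C | IsSelfAdjoint a} = ⊤ := by
          refine eq_top_iff.2 fun a _ => ?_
          rw [← realPart_add_I_smul_imaginaryPart a]
          exact add_mem (Submodule.subset_span (realPart a).2)
            (Submodule.smul_mem _ _ (Submodule.subset_span (imaginaryPart a).2))
        rw [h]
        exact dense_univ }

theorem isClosed_image_starAlgEquiv {A B : Type*} [CStarAlgebra A] [CStarAlgebra B]
    (e : A ≃⋆ₐ[ℂ] B) {J : Set A} (hJ : IsClosed J) : IsClosed (e.toStarAlgHom '' J) :=
  (StarAlgEquiv.isometry e).isClosedEmbedding.isClosedMap J hJ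

/-- Between commutative C⋆-algebras, the closed range condition in the definition of an I⋆-morphism
is automatic: by Gelfand duality every unital ⋆-morphism is a composition operator. -/
theorem isClosed_image_starAlgHom {A B : Type*} [CommCStarAlgebra A] [CommCStarAlgebra B]
    (ρ : A →⋆ₐ[ℂ] B) {J : Set A} (hJ : IsPreIsocone J) : IsClosed (ρ '' J) := by
  have hG := hJ.image (gelfandStarTransform A).toStarAlgHom
    (isClosed_image_starAlgEquiv _ hJ.isClosed)
  have h := isClosed_image_starAlgEquiv (gelfandStarTransform B).symm
    (isClosed_image_comp (CharacterSpace.compContinuousMap ρ) hG)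
  convert! h using 1
  rw [Set.image_image, Set.image_image]
  exact Set.image_congr fun a _ => ((gelfandStarTransform B).symm_apply_apply (ρ a)).symm

/-- An isocone of `C` is the set of all elements whose Gelfand transform is real and isotone. -/
theorem gelfandStarTransform_mem_isotoneCone_iff {C : Type*} [CommCStarAlgebra C] {I : Set C}
    (hI : IsIsocone I) {a : C} :
    letI := charOrder hI
    gelfandStarTransform C a ∈ isotoneCone (characterSpace ℂ C) ↔ a ∈ I := by
  let := charOrder hI
  refine ⟨fun ha => ?_, fun ha => ⟨fun χ => ?_, fun φ ψ h => h a ha⟩⟩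
  · have hG := hI.toIsPreIsocone.image (gelfandStarTransform C).toStarAlgHom
      (isClosed_image_starAlgEquiv _ hI.isClosed)
    obtain ⟨b, hb, hba⟩ := hG.mem_of_isotone ha.1 fun φ ψ h =>
      ha.2 fun c hc => h _ (Set.mem_image_of_mem _ hc)
    exact (gelfandStarTransform C).injective hba ▸ hb
  · exact Complex.conj_eq_iff_im.mp ((hI.isSelfAdjoint a ha).map χ).star_eq

theorem isSelfAdjoint_iff_forall_im_eq_zero {C : Type*} [CommCStarAlgebra C] {a : C} :
    IsSelfAdjoint a ↔ ∀ χ : characterSpace ℂ C, (χ a).im = 0 := by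
  refine ⟨fun ha χ => Complex.conj_eq_iff_im.mp (ha.map χ).star_eq, fun h => ?_⟩
  refine (gelfandStarTransform C).injective (ContinuousMap.ext fun χ => ?_)
  exact (map_star χ a).trans (Complex.conj_eq_iff_im.mpr (h χ))

theorem cone_eq_setOf_isSelfAdjoint_iff {C : Type*} [CommCStarAlgebra C] {I : Set C}
    (hI : IsIsocone I) :
    letI := charOrder hI
    I = {a | IsSelfAdjoint a} ↔ ∀ φ ψ : characterSpace ℂ C, φ ≤ ψ → φ = ψ := by
  let := charOrder hI
  refine ⟨fun h φ ψ hφψ => le_antisymm hφψ fun c hc => ?_, fun h => ?_⟩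
  · have hneg : -c ∈ I := h ▸ (hI.isSelfAdjoint c hc).neg
    simpa using hφψ _ hneg
  · refine Set.Subset.antisymm hI.isSelfAdjoint fun a ha => ?_
    refine (gelfandStarTransform_mem_isotoneCone_iff hI).1
      ⟨isSelfAdjoint_iff_forall_im_eq_zero.1 ha, fun φ ψ hφψ => ?_⟩
    rw [h φ ψ hφψ]

/-! ### The natural isomorphisms -/

theorem AbIC.hom_ext {A B : AbIC.{u}} {f g : A ⟶ B}
    (h : ∀ a, IStarHom.toStarAlgHom f a = IStarHom.toStarAlgHom g a) : f = g :=
  IStarHom.ext (funext h)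

/-- The Gelfand transform, as an isomorphism of I⋆-algebras. -/
noncomputable def AbIC.gelfandIso (A : AbIC.{u}) : A ≅ A.hatObj.isotoneObj where
  hom :=
    { toStarAlgHom := (gelfandStarTransform A.carrier).toStarAlgHom
      map_mem' := fun _ ha => (gelfandStarTransform_mem_isotoneCone_iff A.isIsocone).2 ha
      isClosed_image' := fun _ hJ _ => isClosed_image_starAlgEquiv _ hJ.isClosed }
  inv :=
    { toStarAlgHom := (gelfandStarTransform A.carrier).symm.toStarAlgHom
      map_mem' := fun f hf => (gelfandStarTransform_mem_isotoneCone_iff A.isIsocone).1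
        (((gelfandStarTransform A.carrier).apply_symm_apply f).symm ▸ hf)
      isClosed_image' := fun _ hJ _ => isClosed_image_starAlgEquiv _ hJ.isClosed }
  hom_inv_id := AbIC.hom_ext (gelfandStarTransform A.carrier).symm_apply_apply
  inv_hom_id := AbIC.hom_ext (gelfandStarTransform A.carrier).apply_symm_apply

theorem IsToposet.le_iff_forall_isotoneCone {M : Type*} [TopologicalSpace M] [PartialOrder M]
    (hM : IsToposet M) {x y : M} : x ≤ y ↔ ∀ g ∈ isotoneCone M, (g x).re ≤ (g y).re := by
  refine ⟨fun h g hg => hg.2 h, fun h => (hM x y).2 fun f hfc hfm => ?_⟩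
  let g : C(M, ℂ) := ⟨fun z => (f z : ℂ), by fun_prop⟩
  exact h g ⟨fun z => Complex.ofReal_im _, hfm⟩

/-- Evaluation at the points of `M`, as an isomorphism of compact toposets from `M` to the
characters of `C(M)`. -/
noncomputable def CompactToposet.evalIso (M : CompactToposet.{u}) : M ≅ M.isotoneObj.hatObj :=
  have := M.isToposet.t2Space
  letI := charOrder (isIsocone_isotoneCone M.isToposet)
  let e : M.carrier ≃ₜ characterSpace ℂ C(M.carrier, ℂ) := CharacterSpace.homeoEval M.carrier ℂ
  have he : ∀ x y, e x ≤ e y ↔ x ≤ y := fun _ _ => M.isToposet.le_iff_forall_isotoneCone.symm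
  have he_symm : ∀ φ ψ, φ ≤ ψ → e.symm φ ≤ e.symm ψ := fun φ ψ h =>
    (he _ _).1 (by rwa [e.apply_symm_apply, e.apply_symm_apply])
  { hom :=
      { toFun := e
        monotone' := fun x y h => (he x y).2 h
        continuous_toFun := e.continuous }
    inv :=
      { toFun := e.symm
        monotone' := he_symm
        continuous_toFun := e.symm.continuous }
    hom_inv_id := ContinuousOrderHom.ext e.symm_apply_apply
    inv_hom_id := ContinuousOrderHom.ext e.apply_symm_apply }

/-- The dual equivalence given by `AbIC.hat` and `CompactToposet.isotone`, with natural isomorphisms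
coming from the Gelfand transform (read in the opposite category) and evaluation at points. -/
noncomputable def hatEquivalence : AbIC.{u}ᵒᵖ ≌ CompactToposet.{u} :=
  .mk AbIC.hat CompactToposet.isotone.rightOp
    (NatIso.ofComponents (F := AbIC.hat ⋙ CompactToposet.isotone.rightOp) (G := 𝟭 _)
      (fun A => A.unop.gelfandIso.op) fun _ => Quiver.Hom.unop_inj (AbIC.hom_ext fun _ => rfl)).symm
    (NatIso.ofComponents (F := 𝟭 _) (G := CompactToposet.isotone.rightOp ⋙ AbIC.hat)
      CompactToposet.evalIso fun _ => rfl).symm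

theorem mainTheorem2 :
    -- the functors `^` and `𝓘` are mutually quasi-inverse, hence a dual equivalence
    (∃ e : AbIC.{u}ᵒᵖ ≌ CompactToposet.{u},
      e.functor = AbIC.hat ∧ e.inverse = CompactToposet.isotone.rightOp) ∧
    -- compact toposets are the same as compact pospaces
    (∀ (M : Type u) [TopologicalSpace M] [PartialOrder M] [CompactSpace M],
      IsToposet M ↔ IsClosed {p : M × M | p.1 ≤ p.2}) ∧
    -- commutative C⋆-algebras `C`, viewed as the I⋆-algebras `(Re C, C)` ...
    (∀ (C : Type u) [CommCStarAlgebra C], IsIsocone {a : C | IsSelfAdjoint a}) ∧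
    -- ... with all unital ⋆-morphisms between them ...
    (∀ (A B : AbIC.{u}), B.cone = {b | IsSelfAdjoint b} →
      ∀ ρ : A.carrier →⋆ₐ[ℂ] B.carrier, ∃ f : IStarHom A.cone B.cone, f.toStarAlgHom = ρ) ∧
    -- ... correspond to the compact spaces with the trivial order
    (∀ A : AbIC.{u}, A.cone = {a | IsSelfAdjoint a} ↔
      ∀ φ ψ : A.hatObj.carrier, φ ≤ ψ → φ = ψ) := by
  refine ⟨⟨hatEquivalence, rfl, rfl⟩, fun M _ _ _ => isToposet_iff_isClosed_le,
    fun C _ => isIsocone_setOf_isSelfAdjoint C, fun A B hB ρ => ?_,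
    fun A => cone_eq_setOf_isSelfAdjoint_iff A.isIsocone⟩
  refine ⟨⟨ρ, fun a ha => ?_, fun J hJ _ => isClosed_image_starAlgHom ρ hJ⟩, rfl⟩
  rw [hB]
  exact (A.isIsocone.isSelfAdjoint a ha).map ρ
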